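/- Let $E$ be a Polish space with its Borel $\sigma$-algebra and let $X=(X_t)_{t\ge 0}$ be a Feller process in $E$ with càdlàg paths: a measurable family $(\mathbb P_x)_{x\in E}$ of probability measures on the space of càdlàg paths $[0,\infty)\to E$ with $\mathbb P_x(X_0=x)=1$, which has the time-homogeneous Markov property for the canonical filtration, and for which $x\mapsto \mathbb E_x f(X_t)$ is continuous for every bounded continuous $f$. Let $S_tf(x)=\mathbb E_x f(X_t)$ be its semigroup and $\delta_xS_t$ the distribution of $X_t$ under $\mathbb P_x$. Let $\rho:E\times E\to[0,\infty]$ be a lower semi-continuous metric (symmetric, with the triangle inequality, and with $\rho(x,y)=0$ if and only if $x=y$; the value $\infty$ is allowed, and $\rho$ need not induce the topology of $E$; we use $0\cdot\infty=0$). For $f:E\to\mathbb R$ put $$\|f\|_{Lip}=\inf\{r\in[0,\infty):\ f(x)-f(y)\le r\rho(x,y)\ \ \forall x,y\in E\}\qquad(\inf\emptyset=\infty),$$ and let $\|S_t\|_{Lip}=\sup\|S_tf\|_{Lip}$, where the supremum (equal to $0$ if it is over the empty set) is over all Borel functions $f:E\to\mathbb R$ with $\|f\|_{Lip}=1$ and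 $\mathbb E_x|f(X_t)|<\infty$ for all $x\in E$. Define the optimal coupling distance $$\rho_t(x,y)=\inf_{\pi}\int\rho(x',y')\,\pi(dx'\,dy'),$$ the infimum being over all couplings $\pi$ of $\delta_xS_t$ and $\delta_yS_t$, and the generalized coupling time $h(x,y)=\int_0^\infty\rho_t(x,y)\,dt$. **Theorem.** Assume that $X$ acts as a contraction for $\rho$, i.e. $\rho_t(x,y)\le\rho(x,y)$ for all $t\ge0$ and $x,y\in E$. Then there is $M\in[0,\infty)$ with $h\le M\rho$ on $E\times E$ if and only if the semigroup is exponentially contracting, i.e. there are $C\in[0,\infty)$ and $c>0$ with $\|S_t\|_{Lip}\le Ce^{-ct}$ for all $t\ge0$. More precisely, for every $\alpha>1$: a) if $M\in[0,\infty)$ and $h(x,y)\le M\rho(x,y)$ for all $x,y\in E$, then $\|S_t\|_{Lip}\le\frac1\alpha$ for all $t\ge M\alpha$; b) if $T>0$ and $\|S_T\|_{Lip}\le\frac1\alpha$, then $h(x,y)\le\frac{\alpha T}{\alpha-1}\,\rho(x,y)$ for all $x,y\in E$. -/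

import Mathlib

open MeasureTheory ProbabilityTheory Filter Topology
open scoped NNReal ENNReal BoundedContinuousFunction

noncomputable section

namespace CouplingTime

/-- `ω : [0,∞) → E` is càdlàg: right-continuous with left limits. (At `t = 0` the filter `𝓝[<] t`
is trivial, so nothing is asked of a left limit there.) -/
def IsCadlag {E : Type*} [TopologicalSpace E] (ω : ℝ≥0 → E) : Prop :=
  ∀ t : ℝ≥0, ContinuousWithinAt ω (Set.Ici t) t ∧ ∃ l : E, Tendsto ω (𝓝[<] t) (𝓝 l)

/-- The path space of càdlàg trajectories in `E`. It carries the σ-algebra generated by the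
coordinate maps (the trace of the product σ-algebra). -/
abbrev CadlagPath (E : Type*) [TopologicalSpace E] : Type _ :=
  {ω : ℝ≥0 → E // IsCadlag ω}

/-- The canonical filtration `𝓕_t = σ(X_s ; 0 ≤ s ≤ t)` on the path space. -/
abbrev canonicalSigma (E : Type*) [TopologicalSpace E] [MeasurableSpace E] (t : ℝ≥0) :
    MeasurableSpace (CadlagPath E) :=
  ⨆ (s : ℝ≥0) (_ : s ≤ t),
    MeasurableSpace.comap (fun ω : CadlagPath E => ω.1 s) inferInstance

/-- A Feller process with state space `E`: a measurable family `(P_x)_{x ∈ E}` of probability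
measures on càdlàg path space, where `P_x` starts in `x`, with the (time-homogeneous) Markov
property for the canonical filtration, and for which `x ↦ E_x f(X_t)` is continuous for every
bounded continuous `f`. -/
structure FellerProcess (E : Type*) [TopologicalSpace E] [MeasurableSpace E] where
  /-- `law x` is the measure `P_x`. -/
  law : Kernel E (CadlagPath E)
  isMarkovKernel : IsMarkovKernel law
  start : ∀ x : E, ∀ᵐ ω ∂(law x), ω.1 0 = x
  /-- `P_x(X_{s+t} ∈ A | 𝓕_s) = P_{X_s}(X_t ∈ A)`, written as an identity of integrals over
  the events `B ∈ 𝓕_s`. -/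
  markov : ∀ (x : E) (s t : ℝ≥0) (A : Set E), MeasurableSet A →
    ∀ B : Set (CadlagPath E), MeasurableSet[canonicalSigma E s] B →
      law x (B ∩ {ω | ω.1 (s + t) ∈ A}) =
        ∫⁻ ω in B, law (ω.1 s) {ω' | ω'.1 t ∈ A} ∂(law x)
  feller : ∀ (t : ℝ≥0) (f : E →ᵇ ℝ), Continuous fun x : E => ∫ ω, f (ω.1 t) ∂(law x)

section

variable {E : Type*} [TopologicalSpace E] [MeasurableSpace E]

/-- The distribution `δ_x S_t` of `X_t` for the process started in `x`. -/
def FellerProcess.distr (X : FellerProcess E) (t : ℝ≥0) (x : E) : Measure E :=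
  (X.law x).map (fun ω => ω.1 t)

/-- The semigroup: `(S_t f)(x) = E_x f(X_t)`. -/
def FellerProcess.semigroup (X : FellerProcess E) (t : ℝ≥0) (f : E → ℝ) (x : E) : ℝ :=
  ∫ y, f y ∂(X.distr t x)

/-- The couplings of `μ` and `ν`: the measures on `E × E` with marginals `μ` and `ν`. -/
def couplings (μ ν : Measure E) : Set (Measure (E × E)) :=
  {π | π.map Prod.fst = μ ∧ π.map Prod.snd = ν}

/-- The optimal coupling distance `ρ_t(x,y)`. -/
def FellerProcess.couplingDist (X : FellerProcess E) (ρ : E → E → ℝ≥0∞) (t : ℝ≥0) (x y : E) :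
    ℝ≥0∞ :=
  ⨅ π ∈ couplings (X.distr t x) (X.distr t y), ∫⁻ z, ρ z.1 z.2 ∂π

/-- The generalized coupling time `h(x,y) = ∫_0^∞ ρ_t(x,y) dt`. -/
def FellerProcess.couplingTime (X : FellerProcess E) (ρ : E → E → ℝ≥0∞) (x y : E) : ℝ≥0∞ :=
  ∫⁻ t in Set.Ici (0 : ℝ), X.couplingDist ρ t.toNNReal x y

/-- The process acts as a contraction for the distance `ρ`: `ρ_t ≤ ρ` for all `t ≥ 0`. -/
def FellerProcess.ActsAsContraction (X : FellerProcess E) (ρ : E → E → ℝ≥0∞) : Prop :=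
  ∀ (t : ℝ≥0) (x y : E), X.couplingDist ρ t x y ≤ ρ x y

/-- The Lipschitz seminorm `inf {r ≥ 0 : f(x) - f(y) ≤ r ρ(x,y) for all x, y}`, with value `∞`
if there is no such `r`. -/
def lipNorm {E : Type*} (ρ : E → E → ℝ≥0∞) (f : E → ℝ) : ℝ≥0∞ :=
  ⨅ (r : ℝ≥0) (_ : ∀ x y : E, ENNReal.ofReal (f x - f y) ≤ (r : ℝ≥0∞) * ρ x y), (r : ℝ≥0∞)

/-- The operator seminorm `‖S_t‖_Lip = sup {‖S_t f‖_Lip : ‖f‖_Lip = 1}`, where `f` runs over the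
Borel functions for which `S_t f` is defined, i.e. `E_x |f(X_t)| < ∞` for every `x`. -/
def FellerProcess.opLipNorm (X : FellerProcess E) (ρ : E → E → ℝ≥0∞) (t : ℝ≥0) : ℝ≥0∞ :=
  ⨆ (f : E → ℝ) (_ : Measurable f) (_ : ∀ x : E, Integrable f (X.distr t x))
    (_ : lipNorm ρ f = 1), lipNorm ρ (X.semigroup t f)

/-- `‖S_t‖_Lip` decays exponentially fast. -/
def FellerProcess.ExponentiallyContracting (X : FellerProcess E) (ρ : E → E → ℝ≥0∞) : Prop :=
  ∃ (C : ℝ≥0) (c : ℝ), 0 < c ∧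
    ∀ t : ℝ≥0, X.opLipNorm ρ t ≤ (C : ℝ≥0∞) * ENNReal.ofReal (Real.exp (-(c * (t : ℝ))))

end

/-- `ρ` is a metric on the set `E`; as usual for coupling costs the value `∞` is permitted. It is
not required to induce the topology of `E`. -/
structure IsMetric {E : Type*} (ρ : E → E → ℝ≥0∞) : Prop where
  eq_zero_iff : ∀ x y : E, ρ x y = 0 ↔ x = y
  symm : ∀ x y : E, ρ x y = ρ y x
  triangle : ∀ x y z : E, ρ x z ≤ ρ x y + ρ y z

end CouplingTime

end

/-!
The two estimates compare `ρ_t` with the increments of `S_t f` over `1`-Lipschitz `f`.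

If `h ≤ M ρ`, let `f` be bounded and `1`-Lipschitz. For `s ≤ t` one has `S_t f = S_s (S_{t-s} f)`,
and `S_{t-s} f` is again `1`-Lipschitz because the process is a contraction; integrating it against
couplings at time `s` gives `S_t f(x) - S_t f(y) ≤ ρ_s(x, y)`. Integration over `s ∈ [0, t]` yields
`t (S_t f(x) - S_t f(y)) ≤ h(x, y) ≤ M ρ(x, y)`
(`FellerProcess.ActsAsContraction.mul_ofReal_semigroup_sub_le`). Unbounded `f` are reached by
truncation. When `t = 0`, and so `M = 0`, this says nothing; but then `h = 0`, which forces the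
state space to have at most one point
(`FellerProcess.ActsAsContraction.subsingleton_of_couplingTime_eq_zero`).

If `‖S_T‖_Lip ≤ 1/α`, then `S_{kT+s} f` is `α⁻ᵏ`-Lipschitz for bounded `1`-Lipschitz `f`. By
Kantorovich–Rubinstein duality `ρ_{kT+s} ≤ α⁻ᵏ ρ`, and summing over the intervals `[kT, (k+1)T)`
bounds `h` by a geometric series. The exponential decay of `‖S_t‖_Lip` follows from the two
estimates with `α = 2`.

The duality is needed for a lower semicontinuous extended metric and *Borel* test functions. On a
compact metrizable space it follows from the M. Riesz extension theorem, applied to a cone that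
encodes the marginals and the cost, together with the Riesz–Markov–Kakutani theorem
(`exists_coupling_of_compact`). A Polish space is embedded in the Hilbert cube
(`exists_coupling_of_forall_continuous`). For a metric cost, the dual pairs of continuous functions
are replaced by single Lipschitz functions through an infimal convolution over compact sets
(`exists_coupling_of_forall_lipschitz`).
-/

namespace CouplingTime

/-! ### Kantorovich duality on compact metrizable spaces -/

section Compact

variable {Y : Type*} [TopologicalSpace Y] [CompactSpace Y] [T2Space Y] [MeasurableSpace Y]
  [BorelSpace Y]

/-- A lower semicontinuous function is the supremum of a sequence of continuous functions, by
Urysohn's lemma and the Lindelöf property, so bounds on its integral may be tested on the continuous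
functions below it. -/
lemma lintegral_le_of_forall_continuous_le [SecondCountableTopology Y] {c : Y → ℝ≥0∞}
    (hc : LowerSemicontinuous c) (m : Measure Y) (D : ℝ≥0∞)
    (H : ∀ v : C(Y, ℝ), (∀ z, ENNReal.ofReal (v z) ≤ c z) →
      ∫⁻ z, ENNReal.ofReal (v z) ∂m ≤ D) :
    ∫⁻ z, c z ∂m ≤ D := by
  let 𝓕 : Set (Y → ℝ≥0∞) :=
    {g | ∃ v : C(Y, ℝ), (∀ z, ENNReal.ofReal (v z) ≤ c z) ∧ g = fun z => ENNReal.ofReal (v z)}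
  have hlub : IsLUB 𝓕 c := by
    refine ⟨?_, fun b hb z => ?_⟩
    · rintro g ⟨v, hv, rfl⟩ z
      exact hv z
    · refine le_of_forall_lt fun a ha => ?_
      obtain ⟨a', haa', ha'⟩ := exists_between ha
      have hopen : IsOpen {w | a' < c w} := hc.isOpen_preimage a'
      obtain ⟨f, hf0, hf1, hf01⟩ := exists_continuous_zero_one_of_isClosed
        (s := {w | a' < c w}ᶜ) (t := {z}) hopen.isClosed_compl isClosed_singleton
        (by simpa using ha')
      have hmem : (fun w => ENNReal.ofReal ((a'.toReal • f) w)) ∈ 𝓕 := by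
        refine ⟨a'.toReal • f, fun w => ?_, rfl⟩
        by_cases hw : a' < c w
        · refine le_trans ?_ hw.le
          refine ENNReal.ofReal_le_of_le_toReal ?_
          simpa using mul_le_of_le_one_right ENNReal.toReal_nonneg (hf01 w).2
        · have : f w = 0 := hf0 (by simpa using hw)
          simp [this]
      have h1 := hb hmem z
      have h2 : f z = 1 := hf1 (by simp)
      simp only [ContinuousMap.smul_apply, h2, smul_eq_mul, mul_one] at h1
      rw [ENNReal.ofReal_toReal (ne_top_of_lt ha')] at h1
      exact haa'.trans_le h1
  obtain ⟨𝓕', hsub, hcount, hlub'⟩ := exists_countable_lowerSemicontinuous_isLUB (s := c)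
    (𝓕 := 𝓕) (by
      rintro g ⟨v, -, rfl⟩
      exact (ENNReal.continuous_ofReal.comp v.continuous).lowerSemicontinuous) hlub
  have hne : (insert (fun _ => (0 : ℝ≥0∞)) 𝓕').Nonempty := Set.insert_nonempty _ _
  obtain ⟨g, hg⟩ := (hcount.insert (fun _ => (0 : ℝ≥0∞))).exists_eq_range hne
  have hgmem : ∀ n, ∃ v : C(Y, ℝ), (∀ z, ENNReal.ofReal (v z) ≤ c z) ∧
      g n = fun z => ENNReal.ofReal (v z) := by
    intro n
    have : g n ∈ insert (fun _ => (0 : ℝ≥0∞)) 𝓕' := hg ▸ Set.mem_range_self n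
    rcases this with h | h
    · exact ⟨0, by simp, by rw [h]; simp⟩
    · exact hsub h
  choose v hv hgv using hgmem
  -- The partial suprema increase to `c`, so monotone convergence applies.
  have hps : ∀ n z, ENNReal.ofReal (partialSups v n z) ≤ c z := by
    intro n
    induction n with
    | zero => simpa using hv 0
    | succ n ih =>
      intro z
      rw [← Order.succ_eq_add_one, partialSups_succ, ContinuousMap.sup_apply,
        ENNReal.ofReal_max]
      exact max_le (ih z) (hv _ z)
  have hc_le : ∀ z, c z ≤ ⨆ n, ENNReal.ofReal (partialSups v n z) := by
    refine hlub'.2 ?_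
    intro f hf
    obtain ⟨n, rfl⟩ : f ∈ Set.range g := hg ▸ Set.mem_insert_of_mem _ hf
    intro z
    rw [hgv]
    exact le_iSup_of_le n (ENNReal.ofReal_le_ofReal (le_partialSups v n z))
  calc ∫⁻ z, c z ∂m ≤ ∫⁻ z, ⨆ n, ENNReal.ofReal (partialSups v n z) ∂m := lintegral_mono hc_le
    _ = ⨆ n, ∫⁻ z, ENNReal.ofReal (partialSups v n z) ∂m := by
        refine lintegral_iSup (fun n => ?_) fun i j hij z => ?_
        · exact (ENNReal.continuous_ofReal.comp (partialSups v n).continuous).measurable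
        · exact ENNReal.ofReal_le_ofReal ((partialSups v).monotone hij z)
    _ ≤ D := iSup_le fun n => H _ (hps n)

/-- The Riesz–Markov–Kakutani theorem on a compact space, for functionals on `C(Y, ℝ)`. -/
lemma exists_measure_integral_eq_of_nonneg (L : C(Y, ℝ) →ₗ[ℝ] ℝ)
    (hL : ∀ v : C(Y, ℝ), (∀ z, 0 ≤ v z) → 0 ≤ L v) :
    ∃ m : Measure Y, IsFiniteMeasure m ∧ ∀ v : C(Y, ℝ), ∫ z, v z ∂m = L v := by
  let Λ : CompactlySupportedContinuousMap Y ℝ →ₚ[ℝ] ℝ := PositiveLinearMap.mk₀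
    { toFun := fun f => L f.toContinuousMap
      map_add' := fun f g => L.map_add f.toContinuousMap g.toContinuousMap
      map_smul' := fun r f => L.map_smul r f.toContinuousMap }
    (fun f hf => hL _ fun z => hf z)
  have hcs : ∀ v : C(Y, ℝ), HasCompactSupport v := fun v => HasCompactSupport.of_compactSpace v
  refine ⟨RealRMK.rieszMeasure Λ, ⟨?_⟩, fun v => ?_⟩
  · refine (RealRMK.rieszMeasure_le_of_eq_one Λ (f := ⟨1, hcs 1⟩) (fun _ => ?_) isCompact_univ
      (fun _ _ => ?_)).trans_lt ENNReal.ofReal_lt_top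
    · simp
    · simp
  · exact RealRMK.integral_rieszMeasure Λ ⟨v, hcs v⟩


/-- Linearised form of the dual constraint: if `c` dominates `φ(x) - ψ(y)` up to the factor `l`,
then the dual value is at most `l D`. -/
lemma dual_value_le_mul {K : Type*} [TopologicalSpace K] [MeasurableSpace K]
    {c : K × K → ℝ≥0∞} {μ ν : Measure K} {D : ℝ}
    (H : ∀ φ ψ : C(K, ℝ), (∀ x y, ENNReal.ofReal (φ x - ψ y) ≤ c (x, y)) →
      ∫ x, φ x ∂μ - ∫ y, ψ y ∂ν ≤ D) {l : ℝ} (hl : 0 ≤ l) (φ ψ : C(K, ℝ))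
    (h : ∀ x y, ENNReal.ofReal (φ x - ψ y) ≤ ENNReal.ofReal l * c (x, y)) :
    ∫ x, φ x ∂μ - ∫ y, ψ y ∂ν ≤ l * D := by
  have key : ∀ l : ℝ, 0 < l →
      (∀ x y, ENNReal.ofReal (φ x - ψ y) ≤ ENNReal.ofReal l * c (x, y)) →
      ∫ x, φ x ∂μ - ∫ y, ψ y ∂ν ≤ l * D := by
    intro l hl h
    have h1 := H (l⁻¹ • φ) (l⁻¹ • ψ) fun x y => by
      simp only [ContinuousMap.smul_apply, smul_eq_mul]
      rw [← mul_sub, ENNReal.ofReal_mul (by positivity)]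
      calc ENNReal.ofReal l⁻¹ * ENNReal.ofReal (φ x - ψ y)
          ≤ ENNReal.ofReal l⁻¹ * (ENNReal.ofReal l * c (x, y)) := by gcongr; exact h x y
        _ = c (x, y) := by
          rw [← mul_assoc, ← ENNReal.ofReal_mul (by positivity), inv_mul_cancel₀ hl.ne']
          simp
    simp only [ContinuousMap.smul_apply, smul_eq_mul, integral_const_mul] at h1
    rw [← mul_sub] at h1
    calc _ = l * (l⁻¹ * (∫ x, φ x ∂μ - ∫ y, ψ y ∂ν)) := by field_simp
      _ ≤ l * D := by gcongr
  -- The value `l = 0` is reached as a limit; this avoids dividing by zero.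
  have hlim : Tendsto (fun ε : ℝ => (l + ε) * D) (𝓝[>] 0) (𝓝 ((l + 0) * D)) :=
    ((by fun_prop : Continuous fun ε : ℝ => (l + ε) * D).tendsto 0).mono_left
      nhdsWithin_le_nhds
  rw [add_zero] at hlim
  refine ge_of_tendsto hlim ?_
  filter_upwards [self_mem_nhdsWithin] with ε hε
  refine key _ (add_pos_of_nonneg_of_pos hl hε) fun x y => (h x y).trans ?_
  gcongr
  exact le_add_of_nonneg_right (le_of_lt hε)

/-- The cone of pairs `(w, r)` for which `w` dominates `φ(x) - ψ(y) - l c(x, y)` for some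
continuous `φ`, `ψ` and `l ≥ 0` with `l D - (∫ φ dμ - ∫ ψ dν) ≤ r`. A linear functional
`(w, r) ↦ L w + r` that is nonnegative on it is integration against a coupling of `μ` and `ν`
of cost at most `D`. -/
def dualCone {K : Type*} [TopologicalSpace K] [CompactSpace K] [MeasurableSpace K] [BorelSpace K]
    (c : K × K → ℝ≥0∞) (μ ν : Measure K) [IsProbabilityMeasure μ] [IsProbabilityMeasure ν]
    (D : ℝ) : PointedCone ℝ (C(K × K, ℝ) × ℝ) where
  carrier := {p | ∃ (φ ψ : C(K, ℝ)) (l : ℝ), 0 ≤ l ∧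
    (∀ x y, ENNReal.ofReal (φ x - ψ y - p.1 (x, y)) ≤ ENNReal.ofReal l * c (x, y)) ∧
    l * D - (∫ x, φ x ∂μ - ∫ y, ψ y ∂ν) ≤ p.2}
  zero_mem' := ⟨0, 0, 0, le_rfl, by simp, by simp⟩
  add_mem' := by
    rintro ⟨w, r⟩ ⟨w', r'⟩ ⟨φ, ψ, l, hl, h, hr⟩ ⟨φ', ψ', l', hl', h', hr'⟩
    have hint : ∀ (m : Measure K) [IsProbabilityMeasure m] (f : C(K, ℝ)), Integrable f m :=
      fun m _ f => f.continuous.integrable_of_hasCompactSupport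
        (HasCompactSupport.of_compactSpace f)
    refine ⟨φ + φ', ψ + ψ', l + l', add_nonneg hl hl', fun x y => ?_, ?_⟩
    · rw [ENNReal.ofReal_add hl hl', add_mul]
      refine le_trans ?_ (add_le_add (h x y) (h' x y))
      refine le_trans (le_of_eq ?_) ENNReal.ofReal_add_le
      congr 1
      simp only [ContinuousMap.add_apply, Prod.mk_add_mk]
      ring
    · simp only [ContinuousMap.add_apply, Prod.mk_add_mk] at hr hr' ⊢
      rw [integral_add (hint μ φ) (hint μ φ'), integral_add (hint ν ψ) (hint ν ψ')]
      linarith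
  smul_mem' := by
    rintro ⟨a, ha⟩ ⟨w, r⟩ ⟨φ, ψ, l, hl, h, hr⟩
    refine ⟨a • φ, a • ψ, a * l, mul_nonneg ha hl, fun x y => ?_, ?_⟩
    · rw [ENNReal.ofReal_mul ha, mul_assoc]
      refine le_trans (le_of_eq ?_) (mul_le_mul_right (h x y) (ENNReal.ofReal a))
      rw [← ENNReal.ofReal_mul ha]
      congr 1
      change a * φ x - a * ψ y - a * w (x, y) = _
      ring
    · change a * l * D - (∫ x, a * φ x ∂μ - ∫ y, a * ψ y ∂ν) ≤ a * r
      rw [integral_const_mul, integral_const_mul]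
      have := mul_le_mul_of_nonneg_left hr ha
      dsimp only at this
      linarith

/-- Kantorovich duality on a compact metrizable space, with attainment of the infimum. -/
theorem exists_coupling_of_compact {K : Type*} [TopologicalSpace K] [CompactSpace K] [T2Space K]
    [SecondCountableTopology K] [MeasurableSpace K] [BorelSpace K] {c : K × K → ℝ≥0∞}
    (hc : LowerSemicontinuous c) {μ ν : Measure K} [IsProbabilityMeasure μ]
    [IsProbabilityMeasure ν] {D : ℝ}
    (H : ∀ φ ψ : C(K, ℝ), (∀ x y, ENNReal.ofReal (φ x - ψ y) ≤ c (x, y)) →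
      ∫ x, φ x ∂μ - ∫ y, ψ y ∂ν ≤ D) :
    ∃ π ∈ couplings μ ν, ∫⁻ z, c z ∂π ≤ ENNReal.ofReal D := by
  -- On the line `{0} × ℝ` the functional is `(0, r) ↦ r`.
  let f : (C(K × K, ℝ) × ℝ) →ₗ.[ℝ] ℝ :=
    { domain := LinearMap.range (LinearMap.inr ℝ C(K × K, ℝ) ℝ)
      toFun := (LinearMap.snd ℝ C(K × K, ℝ) ℝ).comp (Submodule.subtype _) }
  obtain ⟨g, hgf, hg⟩ := riesz_extension (dualCone c μ ν D) f
    (by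
      rintro ⟨_, r, rfl⟩ ⟨φ, ψ, l, hl, h, hr⟩
      have := dual_value_le_mul H hl φ ψ fun x y => by simpa using h x y
      change 0 ≤ r
      change _ ≤ r at hr
      linarith)
    (by
      rintro ⟨w, r⟩
      refine ⟨⟨(0, ‖w‖ - r), ⟨‖w‖ - r, rfl⟩⟩, ContinuousMap.const K (-‖w‖), 0, 0, le_rfl,
        fun x y => ?_, ?_⟩
      · have := neg_le_of_abs_le (w.norm_coe_le_norm (x, y))
        have h0 : ENNReal.ofReal (-‖w‖ - 0 - (0 + w (x, y))) = 0 :=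
          ENNReal.ofReal_of_nonpos (by linarith)
        exact h0.le.trans zero_le
      · simp)
  let L : C(K × K, ℝ) →ₗ[ℝ] ℝ := g.comp (LinearMap.inl ℝ C(K × K, ℝ) ℝ)
  have hgL : ∀ w r, g (w, r) = L w + r := by
    intro w r
    have h1 : g (0, r) = r := hgf ⟨(0, r), ⟨r, rfl⟩⟩
    have h2 : ((w, r) : C(K × K, ℝ) × ℝ) = (w, 0) + (0, r) := by simp
    rw [h2, map_add, h1]
    rfl
  obtain ⟨π, hπfin, hπ⟩ := exists_measure_integral_eq_of_nonneg L (by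
    intro v hv
    have : 0 ≤ g (v, 0) := hg _ ⟨0, 0, 0, le_rfl, fun x y => by simpa using hv (x, y), by simp⟩
    simpa [hgL] using this)
  have hL_le : ∀ φ ψ : C(K, ℝ), ∫ x, φ x ∂μ - ∫ y, ψ y ∂ν ≤
      L (φ.comp ContinuousMap.fst - ψ.comp ContinuousMap.snd) := by
    intro φ ψ
    have : 0 ≤ g (φ.comp ContinuousMap.fst - ψ.comp ContinuousMap.snd,
        -(∫ x, φ x ∂μ - ∫ y, ψ y ∂ν)) :=
      hg _ ⟨φ, ψ, 0, le_rfl, fun x y => by simp, by simp⟩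
    rw [hgL] at this
    linarith
  have hfst : ∀ φ : C(K, ℝ), L (φ.comp ContinuousMap.fst) = ∫ x, φ x ∂μ := by
    intro φ
    have h1 := hL_le φ 0
    have h2 := hL_le (-φ) 0
    simp only [ContinuousMap.neg_apply, integral_neg, ContinuousMap.zero_apply, integral_zero,
      sub_zero, ContinuousMap.zero_comp] at h1 h2
    rw [show (-φ).comp ContinuousMap.fst = -(φ.comp (ContinuousMap.fst (α := K) (β := K)))
      from rfl, map_neg] at h2
    linarith
  have hsnd : ∀ ψ : C(K, ℝ), L (ψ.comp ContinuousMap.snd) = ∫ x, ψ x ∂ν := by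
    intro φ
    have h1 := hL_le 0 φ
    have h2 := hL_le 0 (-φ)
    simp only [ContinuousMap.neg_apply, integral_neg, ContinuousMap.zero_apply, integral_zero,
      zero_sub, ContinuousMap.zero_comp] at h1 h2
    rw [show (-φ).comp ContinuousMap.snd = -(φ.comp (ContinuousMap.snd (α := K) (β := K)))
      from rfl, neg_neg] at h2
    rw [map_neg] at h1 h2
    rw [map_neg] at h2
    linarith
  refine ⟨π, ⟨?_, ?_⟩, ?_⟩
  · refine ext_of_forall_integral_eq_of_IsFiniteMeasure fun φ => ?_
    rw [integral_map measurable_fst.aemeasurable φ.continuous.measurable.aestronglyMeasurable]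
    exact (hπ (φ.toContinuousMap.comp ContinuousMap.fst)).trans (hfst φ.toContinuousMap)
  · refine ext_of_forall_integral_eq_of_IsFiniteMeasure fun φ => ?_
    rw [integral_map measurable_snd.aemeasurable φ.continuous.measurable.aestronglyMeasurable]
    exact (hπ (φ.toContinuousMap.comp ContinuousMap.snd)).trans (hsnd φ.toContinuousMap)
  · refine lintegral_le_of_forall_continuous_le hc π _ fun v hv => ?_
    -- The positive part of `v` still lies below `c`.
    let v' : C(K × K, ℝ) := v ⊔ 0
    have hv'0 : ∀ z, 0 ≤ v' z := fun z => le_max_right _ _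
    have hvv' : ∀ z, ENNReal.ofReal (v z) = ENNReal.ofReal (v' z) := fun z => by
      simp [v', ENNReal.ofReal_max]
    have hint : Integrable v' π :=
      v'.continuous.integrable_of_hasCompactSupport (HasCompactSupport.of_compactSpace v')
    simp_rw [hvv']
    rw [← ofReal_integral_eq_lintegral_ofReal hint (ae_of_all _ hv'0), hπ]
    refine ENNReal.ofReal_le_ofReal ?_
    have : 0 ≤ g (-v', D) := by
      refine hg _ ⟨0, 0, 1, zero_le_one, fun x y => ?_, by simp⟩
      have := hv (x, y)
      rw [hvv'] at this
      simpa using this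
    rw [hgL, map_neg] at this
    linarith

end Compact

/-! ### Kantorovich duality on Polish spaces -/

section Polish

/-- The lower semicontinuous envelope, along `i : Z → Y`, of a function on `Z`: the supremum over
the open neighbourhoods `U` of a point of the infimum of the function over `i ⁻¹' U`. -/
noncomputable def lscEnvelope {Z Y : Type*} [TopologicalSpace Y] (i : Z → Y) (c : Z → ℝ≥0∞)
    (y : Y) : ℝ≥0∞ :=
  ⨆ (U : Set Y) (_ : IsOpen U) (_ : y ∈ U), ⨅ (z : Z) (_ : i z ∈ U), c z

lemma lowerSemicontinuous_lscEnvelope {Z Y : Type*} [TopologicalSpace Y] (i : Z → Y)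
    (c : Z → ℝ≥0∞) : LowerSemicontinuous (lscEnvelope i c) := by
  intro y a ha
  simp only [lscEnvelope, lt_iSup_iff] at ha
  obtain ⟨U, hU, hy, ha⟩ := ha
  filter_upwards [hU.mem_nhds hy] with y' hy'
  simp only [lscEnvelope, lt_iSup_iff]
  exact ⟨U, hU, hy', ha⟩

lemma lscEnvelope_apply {Z Y : Type*} [TopologicalSpace Z] [TopologicalSpace Y] {i : Z → Y}
    (hi : IsInducing i) {c : Z → ℝ≥0∞} (hc : LowerSemicontinuous c) (z : Z) :
    lscEnvelope i c (i z) = c z := by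
  refine le_antisymm ?_ (le_of_forall_lt fun a ha => ?_)
  · exact iSup_le fun U => iSup_le fun _ => iSup_le fun hz => iInf₂_le z hz
  · obtain ⟨b, hab, hb⟩ := exists_between ha
    obtain ⟨U, hU, hUc⟩ := hi.isOpen_iff.1 (hc.isOpen_preimage b)
    refine hab.trans_le (le_trans ?_ (le_iSup _ U))
    have hz : i z ∈ U := by
      have : z ∈ i ⁻¹' U := hUc ▸ hb
      exact this
    rw [iSup_pos hU, iSup_pos hz]
    refine le_iInf₂ fun w hw => ?_
    have : w ∈ c ⁻¹' Set.Ioi b := hUc ▸ hw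
    exact le_of_lt this

variable {E : Type*} [TopologicalSpace E] [PolishSpace E] [MeasurableSpace E] [BorelSpace E]

/-- Kantorovich duality on a Polish space for a lower semicontinuous cost, with attainment. The
space is embedded in the Hilbert cube, where the cost is replaced by its envelope; an optimal
coupling of the image measures is carried by the image and is pulled back. -/
theorem exists_coupling_of_forall_continuous {c : E × E → ℝ≥0∞} (hc : LowerSemicontinuous c)
    {μ ν : Measure E} [IsProbabilityMeasure μ] [IsProbabilityMeasure ν] {D : ℝ}
    (H : ∀ φ ψ : E →ᵇ ℝ, (∀ x y, ENNReal.ofReal (φ x - ψ y) ≤ c (x, y)) →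
      ∫ x, φ x ∂μ - ∫ y, ψ y ∂ν ≤ D) :
    ∃ π ∈ couplings μ ν, ∫⁻ z, c z ∂π ≤ ENNReal.ofReal D := by
  let := TopologicalSpace.upgradeIsCompletelyMetrizable E
  obtain ⟨e, he⟩ := Metric.PiNatEmbed.exists_embedding_to_hilbert_cube (X := E)
  have hme : MeasurableEmbedding e := he.continuous.measurableEmbedding he.injective
  have hne : Nonempty E := by
    by_contra h
    rw [not_nonempty_iff] at h
    exact IsProbabilityMeasure.ne_zero μ (Measure.eq_zero_of_isEmpty μ)
  obtain ⟨g, hgm, hge⟩ := hme.exists_measurable_extend measurable_id fun _ => hne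
  have hge' : ∀ x, g (e x) = x := fun x => congrFun hge x
  have := Measure.isProbabilityMeasure_map (μ := μ) hme.measurable.aemeasurable
  have := Measure.isProbabilityMeasure_map (μ := ν) hme.measurable.aemeasurable
  let i : E × E → (ℕ → unitInterval) × (ℕ → unitInterval) := Prod.map e e
  have hi : IsInducing i := he.isInducing.prodMap he.isInducing
  obtain ⟨π, ⟨hπ1, hπ2⟩, hπ⟩ := exists_coupling_of_compact
    (lowerSemicontinuous_lscEnvelope i c) (μ := μ.map e) (ν := ν.map e) (D := D) (by
      intro φ ψ h
      rw [integral_map hme.measurable.aemeasurable φ.continuous.aestronglyMeasurable,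
        integral_map hme.measurable.aemeasurable ψ.continuous.aestronglyMeasurable]
      refine H ((BoundedContinuousFunction.mkOfCompact φ).compContinuous ⟨e, he.continuous⟩)
        ((BoundedContinuousFunction.mkOfCompact ψ).compContinuous ⟨e, he.continuous⟩) ?_
      intro x y
      exact (h (e x) (e y)).trans (lscEnvelope_apply hi hc (x, y)).le)
  have hgg : Measurable (Prod.map g g) := hgm.prodMap hgm
  have hinv : ∀ m : Measure E, (m.map e).map g = m := fun m => by
    rw [Measure.map_map hgm hme.measurable, hge, Measure.map_id]
  refine ⟨π.map (Prod.map g g), ⟨?_, ?_⟩, ?_⟩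
  · rw [Measure.map_map measurable_fst hgg]
    change π.map (g ∘ Prod.fst) = μ
    rw [← Measure.map_map hgm measurable_fst, hπ1, hinv]
  · rw [Measure.map_map measurable_snd hgg]
    change π.map (g ∘ Prod.snd) = ν
    rw [← Measure.map_map hgm measurable_snd, hπ2, hinv]
  · rw [lintegral_map hc.measurable hgg]
    refine le_trans (lintegral_mono_ae ?_) hπ
    have hrange : ∀ m : Measure E, ∀ᵐ y ∂(m.map e), e (g y) = y := by
      intro m
      filter_upwards [(ae_map_mem_range e hme.measurableSet_range m)]
      rintro _ ⟨x, rfl⟩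
      rw [hge']
    have h1 : ∀ᵐ z ∂π, e (g z.1) = z.1 :=
      ae_of_ae_map measurable_fst.aemeasurable (hπ1 ▸ hrange μ)
    have h2 : ∀ᵐ z ∂π, e (g z.2) = z.2 :=
      ae_of_ae_map measurable_snd.aemeasurable (hπ2 ▸ hrange ν)
    filter_upwards [h1, h2] with z hz1 hz2
    rw [← lscEnvelope_apply hi hc]
    change lscEnvelope i c (e (g z.1), e (g z.2)) ≤ _
    rw [hz1, hz2]

lemma lowerSemicontinuous_iInf_of_isCompact {Z Y : Type*} [TopologicalSpace Z]
    [TopologicalSpace Y] {K : Set Y} (hK : IsCompact K) {c : Z × Y → ℝ≥0∞}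
    (hc : LowerSemicontinuous c) : LowerSemicontinuous fun z => ⨅ y ∈ K, c (z, y) := by
  intro z a ha
  obtain ⟨b, hab, hb⟩ := exists_between ha
  obtain ⟨U, V, hU, -, hzU, hKV, hUV⟩ := generalized_tube_lemma (isCompact_singleton (x := z)) hK
    (hc.isOpen_preimage b) (by
      rintro ⟨z', y⟩ ⟨hz', hy⟩
      obtain rfl : z' = z := hz'
      exact hb.trans_le (iInf₂_le y hy))
  filter_upwards [hU.mem_nhds (hzU rfl)] with z' hz'
  exact hab.trans_le (le_iInf₂ fun y hy =>
    le_of_lt (show b < c (z', y) from hUV ⟨hz', hKV hy⟩))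

/-- Kantorovich–Rubinstein duality for a lower semicontinuous metric. Given an admissible pair
`φ(x) - ψ(y) ≤ ρ(x, y)`, the function `x ↦ inf_{y ∈ K} (ψ(y) + ρ(x, y))`, cut off at a bound of
`φ` and `ψ`, is `1`-Lipschitz, dominates `φ`, and is dominated by `ψ` on `K`. The infimum is taken
over a compact set `K` carrying nearly all of `ν`, and not over `E`, so that the function is lower
semicontinuous and hence Borel. -/
theorem exists_coupling_of_forall_lipschitz {ρ : E → E → ℝ≥0∞}
    (hlsc : LowerSemicontinuous fun z : E × E => ρ z.1 z.2) (hρ : IsMetric ρ)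
    {μ ν : Measure E} [IsProbabilityMeasure μ] [IsProbabilityMeasure ν] {D : ℝ}
    (H : ∀ f : E → ℝ, Measurable f → (∃ B, ∀ x, |f x| ≤ B) →
      (∀ x y, ENNReal.ofReal (f x - f y) ≤ ρ x y) → ∫ x, f x ∂μ - ∫ x, f x ∂ν ≤ D) :
    ∃ π ∈ couplings μ ν, ∫⁻ z, ρ z.1 z.2 ∂π ≤ ENNReal.ofReal D := by
  refine exists_coupling_of_forall_continuous hlsc fun φ ψ h => ?_
  obtain ⟨B, hB0, hφB, hψB⟩ : ∃ B : ℝ, 0 ≤ B ∧ (∀ x, |φ x| ≤ B) ∧ ∀ x, |ψ x| ≤ B :=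
    ⟨max ‖φ‖ ‖ψ‖, le_max_of_le_left (norm_nonneg _),
      fun x => (φ.norm_coe_le_norm x).trans (le_max_left _ _),
      fun x => (ψ.norm_coe_le_norm x).trans (le_max_right _ _)⟩
  have key : ∀ ε : ℝ, 0 < ε → ∫ x, φ x ∂μ - ∫ y, ψ y ∂ν ≤ D + 2 * B * ε := by
    intro ε hε
    let := TopologicalSpace.upgradeIsCompletelyMetrizable E
    obtain ⟨K, hK, hKε⟩ := isTightMeasureSet_iff_exists_isCompact_measure_compl_le.1
      (isTightMeasureSet_singleton (μ := ν)) (ENNReal.ofReal ε) (by simpa using hε)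
    have hKε := hKε ν rfl
    let G : E → ℝ≥0∞ := fun x =>
      min (⨅ y ∈ K, (ENNReal.ofReal (ψ y + B) + ρ x y)) (ENNReal.ofReal (2 * B))
    have hGm : Measurable G := by
      refine Measurable.min (LowerSemicontinuous.measurable ?_) measurable_const
      refine lowerSemicontinuous_iInf_of_isCompact hK
        (c := fun z : E × E => ENNReal.ofReal (ψ z.2 + B) + ρ z.1 z.2)
        (LowerSemicontinuous.add (Continuous.lowerSemicontinuous ?_) hlsc)
      exact ENNReal.continuous_ofReal.comp (by fun_prop)
    have hGle : ∀ x, G x ≤ ENNReal.ofReal (2 * B) := fun x => min_le_right _ _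
    have hGtop : ∀ x, G x ≠ ∞ := fun x => ne_top_of_le_ne_top ENNReal.ofReal_ne_top (hGle x)
    have hGlip : ∀ x x', G x ≤ G x' + ρ x x' := by
      intro x x'
      simp only [G, min_add]
      refine min_le_min ?_ le_self_add
      simp only [ENNReal.iInf_add]
      refine le_iInf₂ fun y hy => (iInf₂_le y hy).trans ?_
      calc ENNReal.ofReal (ψ y + B) + ρ x y
          ≤ ENNReal.ofReal (ψ y + B) + (ρ x x' + ρ x' y) := by gcongr; exact hρ.triangle x x' y
        _ = _ := by ring
    let f : E → ℝ := fun x => (G x).toReal - B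
    have hfm : Measurable f := hGm.ennreal_toReal.sub_const B
    have hG2 : ∀ x, (G x).toReal ≤ 2 * B := fun x =>
      ENNReal.toReal_le_of_le_ofReal (by positivity) (hGle x)
    have hfB : ∀ x, |f x| ≤ B := fun x => by
      have h1 := hG2 x
      have h2 : 0 ≤ (G x).toReal := ENNReal.toReal_nonneg
      exact abs_le.2 ⟨by simp only [f]; linarith, by simp only [f]; linarith⟩
    have hflip : ∀ x y, ENNReal.ofReal (f x - f y) ≤ ρ x y := by
      intro x y
      have : f x - f y = (G x).toReal - (G y).toReal := by simp only [f]; ring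
      rw [this, ENNReal.ofReal_sub _ ENNReal.toReal_nonneg, ENNReal.ofReal_toReal (hGtop x),
        ENNReal.ofReal_toReal (hGtop y)]
      exact tsub_le_iff_left.2 (hGlip x y)
    have hφf : ∀ x, φ x ≤ f x := by
      intro x
      have : ENNReal.ofReal (φ x + B) ≤ G x := by
        refine le_min (le_iInf₂ fun y _ => ?_) (ENNReal.ofReal_le_ofReal ?_)
        · calc ENNReal.ofReal (φ x + B) = ENNReal.ofReal ((ψ y + B) + (φ x - ψ y)) := by
                congr 1; ring
            _ ≤ ENNReal.ofReal (ψ y + B) + ENNReal.ofReal (φ x - ψ y) := ENNReal.ofReal_add_le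
            _ ≤ _ := by gcongr; exact h x y
        · have := (abs_le.1 (hφB x)).2
          linarith
      have := (ENNReal.ofReal_le_iff_le_toReal (hGtop x)).1 this
      simp only [f]
      linarith
    have hfψ : ∀ x, f x ≤ ψ x + Kᶜ.indicator (fun _ => 2 * B) x := by
      intro x
      have h1 := abs_le.1 (hfB x)
      have h2 := abs_le.1 (hψB x)
      by_cases hx : x ∈ K
      · have : G x ≤ ENNReal.ofReal (ψ x + B) := by
          refine (min_le_left _ _).trans ((iInf₂_le x hx).trans ?_)
          simp [(hρ.eq_zero_iff x x).2 rfl]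
        have := ENNReal.toReal_le_of_le_ofReal (by linarith) this
        simp only [Set.mem_compl_iff, hx, not_true_eq_false, not_false_eq_true,
          Set.indicator_of_notMem, f]
        linarith
      · rw [Set.indicator_of_mem (by exact hx)]
        linarith
    have hfint : ∀ m : Measure E, IsProbabilityMeasure m → Integrable f m := fun m _ =>
      Integrable.of_bound hfm.aestronglyMeasurable B (ae_of_all _ hfB)
    have hind : Integrable (Kᶜ.indicator (fun _ => 2 * B)) ν :=
      (integrable_const _).indicator hK.measurableSet.compl
    have h1 : ∫ x, φ x ∂μ ≤ ∫ x, f x ∂μ :=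
      integral_mono (φ.integrable μ) (hfint μ inferInstance) hφf
    have h2 : ∫ x, f x ∂ν ≤ ∫ x, ψ x ∂ν + 2 * B * ε := by
      refine (integral_mono (hfint ν inferInstance) ((ψ.integrable ν).add hind) hfψ).trans ?_
      simp only [Pi.add_apply]
      rw [integral_add (ψ.integrable ν) hind, integral_indicator hK.measurableSet.compl,
        setIntegral_const, smul_eq_mul, mul_comm]
      gcongr
      exact ENNReal.toReal_le_of_le_ofReal hε.le hKε
    have h3 := H f hfm ⟨B, hfB⟩ hflip
    linarith
  have hlim : Tendsto (fun ε : ℝ => D + 2 * B * ε) (𝓝[>] 0) (𝓝 (D + 2 * B * 0)) :=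
    ((by fun_prop : Continuous fun ε : ℝ => D + 2 * B * ε).tendsto 0).mono_left
      nhdsWithin_le_nhds
  rw [mul_zero, add_zero] at hlim
  exact ge_of_tendsto hlim (by filter_upwards [self_mem_nhdsWithin] with ε hε using key ε hε)

end Polish

/-! ### Lipschitz functions for an extended distance -/

section Lipschitz

variable {E : Type*} {ρ : E → E → ℝ≥0∞} {f : E → ℝ}

/-- `f` is Lipschitz with constant `r` for the extended distance `ρ`, with `0 * ∞ = 0`. -/
def IsLip (ρ : E → E → ℝ≥0∞) (r : ℝ≥0) (f : E → ℝ) : Prop :=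
  ∀ x y : E, ENNReal.ofReal (f x - f y) ≤ (r : ℝ≥0∞) * ρ x y

lemma IsLip.lipNorm_le {r : ℝ≥0} (h : IsLip ρ r f) : lipNorm ρ f ≤ r :=
  iInf₂_le r h

/-- The Lipschitz seminorm bounds the increments of `f`, provided that it is increased to a
positive number: if it is `0`, then `f` may still vary between points at distance `∞`. -/
lemma IsLip.of_lipNorm_le {r : ℝ≥0} (hr : 0 < r) (h : lipNorm ρ f ≤ r) : IsLip ρ r f := by
  intro x y
  have h1 : ENNReal.ofReal (f x - f y) / ρ x y ≤ lipNorm ρ f :=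
    le_iInf₂ fun s hs => ENNReal.div_le_of_le_mul (hs x y)
  exact (ENNReal.div_le_iff_le_mul (Or.inr ENNReal.coe_ne_top)
    (Or.inr (by simp [hr.ne']))).1 (h1.trans h)

lemma IsLip.const_mul {r : ℝ≥0} (a : ℝ≥0) (h : IsLip ρ r f) :
    IsLip ρ (a * r) fun x => a * f x := by
  intro x y
  rw [← mul_sub, ENNReal.ofReal_mul a.coe_nonneg, ENNReal.ofReal_coe_nnreal, ENNReal.coe_mul,
    mul_assoc]
  gcongr
  exact h x y

lemma lipNorm_const_mul_le {a : ℝ≥0} (ha : 0 < a) :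
    lipNorm ρ (fun x => a * f x) ≤ a * lipNorm ρ f := by
  rw [mul_comm, ← ENNReal.div_le_iff_le_mul (Or.inl (by simpa using ha.ne'))
    (Or.inl ENNReal.coe_ne_top)]
  refine le_iInf₂ fun r hr => ENNReal.div_le_of_le_mul ?_
  rw [mul_comm, ← ENNReal.coe_mul]
  exact (IsLip.const_mul a hr).lipNorm_le

lemma lipNorm_const_mul {a : ℝ≥0} (ha : 0 < a) :
    lipNorm ρ (fun x => a * f x) = a * lipNorm ρ f := by
  refine le_antisymm (lipNorm_const_mul_le ha) ?_
  have h := lipNorm_const_mul_le (ρ := ρ) (f := fun x => a * f x) (inv_pos.2 ha)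
  have hf : (fun x => ((a⁻¹ : ℝ≥0) : ℝ) * ((a : ℝ) * f x)) = f := by
    funext x
    have : (a : ℝ) ≠ 0 := by exact_mod_cast ha.ne'
    push_cast
    field_simp
  rw [hf] at h
  calc (a : ℝ≥0∞) * lipNorm ρ f ≤ a * ((a⁻¹ : ℝ≥0) * lipNorm ρ fun x => a * f x) := by gcongr
    _ = lipNorm ρ fun x => a * f x := by
      rw [← mul_assoc, ← ENNReal.coe_mul, mul_inv_cancel₀ ha.ne', ENNReal.coe_one, one_mul]

lemma IsLip.clamp {r : ℝ≥0} (h : IsLip ρ r f) (b : ℝ) :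
    IsLip ρ r fun x => max (-b) (min b (f x)) := by
  intro x y
  refine le_trans ?_ (h x y)
  rcases le_total (f x) (f y) with hxy | hxy
  · rw [ENNReal.ofReal_of_nonpos]
    · exact zero_le
    · have : max (-b) (min b (f x)) ≤ max (-b) (min b (f y)) := by gcongr
      linarith
  · refine ENNReal.ofReal_le_ofReal ?_
    dsimp only
    rw [sub_le_iff_le_add]
    refine max_le ?_ ?_
    · linarith [le_max_left (-b) (min b (f y))]
    · rcases le_total b (f y) with hb | hb
      · have := le_max_right (-b) (min b (f y))
        rw [min_eq_left hb] at this
        rw [min_eq_left (hb.trans hxy), min_eq_left hb]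
        linarith
      · have := le_max_right (-b) (min b (f y))
        rw [min_eq_right hb] at this
        rw [min_eq_right hb]
        linarith [min_le_right b (f x)]

end Lipschitz

/-! ### The semigroup and the coupling distance -/

section Semigroup

variable {E : Type*} [TopologicalSpace E] [MeasurableSpace E]

lemma measurable_cadlagPath_apply (t : ℝ≥0) : Measurable fun ω : CadlagPath E => ω.1 t :=
  (measurable_pi_apply t).comp measurable_subtype_coe

namespace FellerProcess

variable (X : FellerProcess E)

/-- The transition kernel `x ↦ δ_x S_t`. -/
noncomputable def transition (t : ℝ≥0) : Kernel E E :=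
  X.law.map fun ω => ω.1 t

lemma transition_apply (t : ℝ≥0) (x : E) : X.transition t x = X.distr t x :=
  Kernel.map_apply _ (measurable_cadlagPath_apply t) x

instance (t : ℝ≥0) : IsMarkovKernel (X.transition t) :=
  have := X.isMarkovKernel
  Kernel.IsMarkovKernel.map _ (measurable_cadlagPath_apply t)

instance (t : ℝ≥0) (x : E) : IsProbabilityMeasure (X.distr t x) :=
  X.transition_apply t x ▸ inferInstance

/-- The Chapman–Kolmogorov equation. -/
lemma transition_add (s t : ℝ≥0) :
    X.transition (s + t) = X.transition t ∘ₖ X.transition s := by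
  ext x A hA
  have h := X.markov x s t A hA Set.univ MeasurableSet.univ
  rw [Set.univ_inter, Measure.restrict_univ] at h
  rw [Kernel.comp_apply' _ _ _ hA, X.transition_apply, X.transition_apply, distr, distr,
    Measure.map_apply (measurable_cadlagPath_apply _) hA,
    lintegral_map (Kernel.measurable_coe _ hA) (measurable_cadlagPath_apply s)]
  refine h.trans (lintegral_congr fun ω => ?_)
  rw [X.transition_apply, distr, Measure.map_apply (measurable_cadlagPath_apply _) hA]
  rfl

variable {X} {f : E → ℝ} {B : ℝ}

lemma integrable_distr (hf : Measurable f) (hB : ∀ x, |f x| ≤ B) (t : ℝ≥0) (x : E) :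
    Integrable f (X.distr t x) :=
  Integrable.of_bound hf.aestronglyMeasurable B (ae_of_all _ hB)

lemma measurable_semigroup (hf : Measurable f) (t : ℝ≥0) : Measurable (X.semigroup t f) := by
  have : StronglyMeasurable fun x => ∫ y, f y ∂(X.transition t x) :=
    hf.stronglyMeasurable.integral_kernel
  simp only [X.transition_apply] at this
  exact this.measurable

lemma abs_semigroup_le (hB : ∀ x, |f x| ≤ B) (t : ℝ≥0) (x : E) : |X.semigroup t f x| ≤ B := by
  have := norm_integral_le_of_norm_le_const (μ := X.distr t x) (f := f) (ae_of_all _ hB)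
  rwa [probReal_univ, mul_one] at this

lemma semigroup_add (hf : Measurable f) (hB : ∀ x, |f x| ≤ B) (s t : ℝ≥0) :
    X.semigroup (s + t) f = X.semigroup s (X.semigroup t f) := by
  funext x
  have h := integrable_distr (X := X) hf hB (s + t) x
  simp only [semigroup, ← transition_apply, transition_add] at h ⊢
  exact Kernel.integral_comp h

lemma semigroup_const_mul (a : ℝ) (t : ℝ≥0) :
    X.semigroup t (fun x => a * f x) = fun x => a * X.semigroup t f x := by
  funext x
  exact integral_const_mul _ _

variable {ρ : E → E → ℝ≥0∞}

/-- The easy half of Kantorovich duality. -/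
lemma ofReal_semigroup_sub_le (hf : Measurable f) (hB : ∀ x, |f x| ≤ B) {r : ℝ≥0}
    (hr : IsLip ρ r f) (t : ℝ≥0) (x y : E) :
    ENNReal.ofReal (X.semigroup t f x - X.semigroup t f y) ≤ r * X.couplingDist ρ t x y := by
  have key : ∀ π ∈ couplings (X.distr t x) (X.distr t y),
      ENNReal.ofReal (X.semigroup t f x - X.semigroup t f y) ≤ r * ∫⁻ z, ρ z.1 z.2 ∂π := by
    rintro π ⟨h1, h2⟩
    have hi1 : Integrable (fun z : E × E => f z.1) π :=
      (h1 ▸ integrable_distr hf hB t x : Integrable f (π.map Prod.fst)).comp_measurable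
        measurable_fst
    have hi2 : Integrable (fun z : E × E => f z.2) π :=
      (h2 ▸ integrable_distr hf hB t y : Integrable f (π.map Prod.snd)).comp_measurable
        measurable_snd
    have : X.semigroup t f x - X.semigroup t f y = ∫ z, (f z.1 - f z.2) ∂π := by
      rw [integral_sub hi1 hi2, semigroup, semigroup, ← h1, ← h2,
        integral_map measurable_fst.aemeasurable hf.aestronglyMeasurable,
        integral_map measurable_snd.aemeasurable hf.aestronglyMeasurable]
    rw [this, ← lintegral_const_mul' _ _ ENNReal.coe_ne_top]
    refine le_trans (ENNReal.ofReal_le_of_le_toReal ?_) (lintegral_mono fun z => hr z.1 z.2)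
    refine (integral_eq_lintegral_pos_part_sub_lintegral_neg_part (hi1.sub hi2)).trans_le ?_
    exact sub_le_self _ ENNReal.toReal_nonneg
  rcases eq_or_ne r 0 with rfl | hr0
  · have := key ((X.distr t x).prod (X.distr t y)) ⟨by simp, by simp⟩
    simpa using this
  · have hr0' : (r : ℝ≥0∞) ≠ 0 := by simpa using hr0
    rw [mul_comm, ← ENNReal.div_le_iff_le_mul (Or.inl hr0') (Or.inl ENNReal.coe_ne_top)]
    refine le_iInf₂ fun π hπ => ENNReal.div_le_of_le_mul ?_
    rw [mul_comm]
    exact key π hπ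

lemma ActsAsContraction.isLip_semigroup (hX : X.ActsAsContraction ρ) (hf : Measurable f)
    (hB : ∀ x, |f x| ≤ B) {r : ℝ≥0} (hr : IsLip ρ r f) (t : ℝ≥0) :
    IsLip ρ r (X.semigroup t f) := fun x y =>
  (ofReal_semigroup_sub_le hf hB hr t x y).trans (by gcongr; exact hX t x y)

/-- A bound on `‖S_T‖_Lip`, which only involves functions of Lipschitz seminorm exactly `1`,
applies to every bounded Lipschitz function. If the seminorm is positive one rescales; if it is
zero, `f` is Lipschitz with any positive constant, and the contraction property suffices. -/
lemma ActsAsContraction.isLip_semigroup_of_opLipNorm_le (hX : X.ActsAsContraction ρ) {T q : ℝ≥0}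
    (hq : 0 < q) (hT : X.opLipNorm ρ T ≤ q) (hf : Measurable f) (hB : ∀ x, |f x| ≤ B) {r : ℝ≥0}
    (hr0 : 0 < r) (hr : IsLip ρ r f) : IsLip ρ (q * r) (X.semigroup T f) := by
  have hle := hr.lipNorm_le
  obtain ⟨l, hl⟩ : ∃ l : ℝ≥0, (l : ℝ≥0∞) = lipNorm ρ f :=
    ⟨_, ENNReal.coe_toNNReal (ne_top_of_le_ne_top ENNReal.coe_ne_top hle)⟩
  rcases eq_or_ne l 0 with rfl | hl0
  · refine hX.isLip_semigroup hf hB (IsLip.of_lipNorm_le (mul_pos hq hr0) ?_) T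
    rw [← hl, ENNReal.coe_zero]
    exact zero_le
  · have hlpos : 0 < l := pos_iff_ne_zero.2 hl0
    have h1 : lipNorm ρ (fun x => ((l⁻¹ : ℝ≥0) : ℝ) * f x) = 1 := by
      rw [lipNorm_const_mul (inv_pos.2 hlpos), ← hl, ← ENNReal.coe_mul, inv_mul_cancel₀ hl0,
        ENNReal.coe_one]
    have h2 : lipNorm ρ (X.semigroup T fun x => ((l⁻¹ : ℝ≥0) : ℝ) * f x) ≤ q := by
      refine le_trans ?_ hT
      refine le_iSup_of_le (fun x => ((l⁻¹ : ℝ≥0) : ℝ) * f x) ?_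
      refine le_iSup_of_le (hf.const_mul _) ?_
      refine le_iSup_of_le (fun x => (integrable_distr hf hB T x).const_mul _) ?_
      exact le_iSup_of_le h1 le_rfl
    rw [semigroup_const_mul, lipNorm_const_mul (inv_pos.2 hlpos)] at h2
    refine IsLip.of_lipNorm_le (mul_pos hq hr0) ?_
    calc lipNorm ρ (X.semigroup T f)
        = l * ((l⁻¹ : ℝ≥0) * lipNorm ρ (X.semigroup T f)) := by
          rw [← mul_assoc, ← ENNReal.coe_mul, mul_inv_cancel₀ hl0, ENNReal.coe_one, one_mul]
      _ ≤ l * q := by gcongr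
      _ ≤ r * q := by gcongr; exact_mod_cast hl ▸ hle
      _ = ((q * r : ℝ≥0) : ℝ≥0∞) := by rw [ENNReal.coe_mul, mul_comm]

/-- To bound `‖S_t‖_Lip` it suffices to consider bounded functions: an integrable `f` is the limit
of its truncations, which are no less regular. -/
lemma opLipNorm_le_of_forall_bounded {t q : ℝ≥0}
    (H : ∀ f : E → ℝ, Measurable f → (∃ B, ∀ x, |f x| ≤ B) → IsLip ρ 1 f →
      IsLip ρ q (X.semigroup t f)) : X.opLipNorm ρ t ≤ q := by
  refine iSup_le fun f => iSup_le fun hf => iSup_le fun hint => iSup_le fun hlip => ?_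
  refine IsLip.lipNorm_le fun x y => ?_
  have hf1 : IsLip ρ 1 f := IsLip.of_lipNorm_le one_pos (by simp [hlip])
  let g : ℕ → E → ℝ := fun n z => max (-(n : ℝ)) (min n (f z))
  have hgm : ∀ n, Measurable (g n) := fun n => measurable_const.max (measurable_const.min hf)
  have hgf : ∀ n z, |g n z| ≤ |f z| := by
    intro n z
    have hn : (0 : ℝ) ≤ n := n.cast_nonneg
    refine abs_le.2 ⟨?_, ?_⟩
    · rcases le_total (n : ℝ) (f z) with h | h
      · exact le_max_of_le_right (by rw [min_eq_left h]; linarith [abs_nonneg (f z)])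
      · exact le_max_of_le_right (by rw [min_eq_right h]; exact neg_abs_le _)
    · exact max_le (by linarith [abs_nonneg (f z)]) ((min_le_right _ _).trans (le_abs_self _))
  have hgB : ∀ n z, |g n z| ≤ n := by
    intro n z
    have hn : (0 : ℝ) ≤ n := n.cast_nonneg
    exact abs_le.2 ⟨le_max_left _ _, max_le (by linarith) (min_le_left _ _)⟩
  have hlim : ∀ z, Tendsto (fun n => X.semigroup t (g n) z) atTop (𝓝 (X.semigroup t f z)) := by
    intro z
    refine tendsto_integral_of_dominated_convergence (fun w => |f w|)
      (fun n => (hgm n).aestronglyMeasurable) (hint z).abs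
      (fun n => ae_of_all _ fun w => hgf n w) (ae_of_all _ fun w => ?_)
    obtain ⟨N, hN⟩ := exists_nat_ge |f w|
    refine tendsto_const_nhds.congr' ?_
    filter_upwards [eventually_ge_atTop N] with n hn
    have hNn : (N : ℝ) ≤ n := by exact_mod_cast hn
    have := abs_le.1 (hN.trans hNn)
    simp only [g]
    rw [min_eq_right this.2, max_eq_right this.1]
  exact le_of_tendsto (ENNReal.tendsto_ofReal ((hlim x).sub (hlim y)))
    (Eventually.of_forall fun n => H (g n) (hgm n) ⟨n, hgB n⟩ (hf1.clamp n) x y)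

lemma ActsAsContraction.isLip_semigroup_natCast_mul_add (hX : X.ActsAsContraction ρ) {T q : ℝ≥0}
    (hq : 0 < q) (hT : X.opLipNorm ρ T ≤ q) (hf : Measurable f) (hB : ∀ x, |f x| ≤ B)
    (hf1 : IsLip ρ 1 f) (k : ℕ) (s : ℝ≥0) :
    IsLip ρ (q ^ k) (X.semigroup (k * T + s) f) := by
  induction k with
  | zero => simpa using hX.isLip_semigroup hf hB hf1 s
  | succ k ih =>
    have : ((k + 1 : ℕ) : ℝ≥0) * T + s = T + (k * T + s) := by push_cast; ring
    rw [this, semigroup_add hf hB, pow_succ']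
    exact hX.isLip_semigroup_of_opLipNorm_le hq hT (measurable_semigroup hf _)
      (abs_semigroup_le hB _) (pow_pos hq k) ih

lemma ActsAsContraction.opLipNorm_natCast_mul_add_le (hX : X.ActsAsContraction ρ) {T q : ℝ≥0}
    (hq : 0 < q) (hT : X.opLipNorm ρ T ≤ q) (k : ℕ) (s : ℝ≥0) :
    X.opLipNorm ρ (k * T + s) ≤ (q ^ k : ℝ≥0) :=
  opLipNorm_le_of_forall_bounded fun _ hf ⟨_, hB⟩ hf1 =>
    hX.isLip_semigroup_natCast_mul_add hq hT hf hB hf1 k s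

/-- The increments of `S_t f` are bounded by `ρ_s` for every `s ≤ t`, since
`S_t f = S_s (S_{t-s} f)` with `S_{t-s} f` again `1`-Lipschitz. Integration over `s ∈ [0, t]`
gives a bound by the coupling time. -/
lemma ActsAsContraction.mul_ofReal_semigroup_sub_le (hX : X.ActsAsContraction ρ)
    (hf : Measurable f) (hB : ∀ x, |f x| ≤ B) (hf1 : IsLip ρ 1 f) (t : ℝ≥0) (x y : E) :
    t * ENNReal.ofReal (X.semigroup t f x - X.semigroup t f y) ≤ X.couplingTime ρ x y := by
  set d := ENNReal.ofReal (X.semigroup t f x - X.semigroup t f y)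
  have h1 : ∀ s : ℝ, s ∈ Set.Icc 0 (t : ℝ) → d ≤ X.couplingDist ρ s.toNNReal x y := by
    intro s hs
    have hst : s.toNNReal ≤ t := Real.toNNReal_le_iff_le_coe.2 hs.2
    have := ofReal_semigroup_sub_le (X := X) (measurable_semigroup hf (t - s.toNNReal))
      (abs_semigroup_le hB _) (hX.isLip_semigroup hf hB hf1 (t - s.toNNReal)) s.toNNReal x y
    rwa [← semigroup_add hf hB, add_tsub_cancel_of_le hst, ENNReal.coe_one, one_mul] at this
  calc t * d = ∫⁻ _ in Set.Icc 0 (t : ℝ), d := by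
        rw [setLIntegral_const, Real.volume_Icc, sub_zero, ENNReal.ofReal_coe_nnreal, mul_comm]
    _ ≤ ∫⁻ s in Set.Icc 0 (t : ℝ), X.couplingDist ρ s.toNNReal x y :=
        setLIntegral_mono' measurableSet_Icc h1
    _ ≤ X.couplingTime ρ x y := lintegral_mono_set Set.Icc_subset_Ici_self

/-- Writing `t = k T + s` with `k = ⌊t / T⌋`, a bound `‖S_T‖_Lip ≤ 1/2` gives
`‖S_t‖_Lip ≤ 2⁻ᵏ ≤ 2 exp (-(log 2 / T) t)`. -/
lemma ActsAsContraction.exponentiallyContracting (hX : X.ActsAsContraction ρ) {T : ℝ≥0}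
    (hT0 : 0 < T) (hT : X.opLipNorm ρ T ≤ ENNReal.ofReal (1 / 2)) :
    X.ExponentiallyContracting ρ := by
  have hT0' : (0 : ℝ) < T := by exact_mod_cast hT0
  have hlog : 0 < Real.log 2 := Real.log_pos one_lt_two
  refine ⟨2, Real.log 2 / T, by positivity, fun t => ?_⟩
  set k := ⌊t / T⌋₊
  have hkt : (k : ℝ≥0) * T ≤ t := (le_div_iff₀ hT0).1 (Nat.floor_le zero_le)
  have h1 := hX.opLipNorm_natCast_mul_add_le (q := (1 / 2 : ℝ).toNNReal)
    (Real.toNNReal_pos.2 (by norm_num)) hT k (t - k * T)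
  rw [add_tsub_cancel_of_le hkt] at h1
  refine h1.trans ?_
  have h2 : (t : ℝ) / T ≤ k + 1 := by
    exact_mod_cast (Nat.lt_floor_add_one (t / T)).le
  have h3 : (1 / 2 : ℝ) ^ k ≤ 2 * Real.exp (-(Real.log 2 / T * t)) := by
    have h5 : (1 / 2 : ℝ) ^ k = Real.exp (-(k * Real.log 2)) := by
      rw [Real.exp_neg, Real.exp_nat_mul, Real.exp_log two_pos, one_div, inv_pow]
    have h6 : 2 * Real.exp (-(Real.log 2 / T * t)) =
        Real.exp (Real.log 2 - Real.log 2 / T * t) := by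
      rw [sub_eq_add_neg, Real.exp_add, Real.exp_log two_pos]
    rw [h5, h6, Real.exp_le_exp]
    have : Real.log 2 / T * t = Real.log 2 * (t / T) := by ring
    rw [this]
    nlinarith
  calc (((1 / 2 : ℝ).toNNReal ^ k : ℝ≥0) : ℝ≥0∞) = ENNReal.ofReal ((1 / 2) ^ k) := by
        rw [ENNReal.ofReal_pow (by norm_num), ENNReal.coe_pow]
        rfl
    _ ≤ ENNReal.ofReal (2 * Real.exp (-(Real.log 2 / T * t))) := ENNReal.ofReal_le_ofReal h3
    _ = _ := by
        rw [ENNReal.ofReal_mul two_pos.le]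
        simp

lemma ExponentiallyContracting.exists_opLipNorm_le (h : X.ExponentiallyContracting ρ) :
    ∃ T : ℝ≥0, 0 < T ∧ X.opLipNorm ρ T ≤ ENNReal.ofReal (1 / 2) := by
  obtain ⟨C, c, hc, h⟩ := h
  have hC : (0 : ℝ) ≤ C := C.coe_nonneg
  -- With `c T = 2 C + 1` one has `exp (c T) ≥ c T + 1 = 2 (C + 1)`.
  let T : ℝ≥0 := ((2 * C + 1) / c).toNNReal
  have hT : (T : ℝ) = (2 * C + 1) / c := Real.coe_toNNReal _ (by positivity)
  refine ⟨T, Real.toNNReal_pos.2 (by positivity), (h T).trans ?_⟩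
  rw [← ENNReal.ofReal_coe_nnreal, ← ENNReal.ofReal_mul hC]
  refine ENNReal.ofReal_le_ofReal ?_
  have hcT : c * T = 2 * C + 1 := by rw [hT]; field_simp
  rw [hcT, Real.exp_neg, ← div_eq_mul_inv, div_le_div_iff₀ (Real.exp_pos _) two_pos]
  have := Real.add_one_le_exp (2 * (C : ℝ) + 1)
  linarith

end FellerProcess

end Semigroup

/-! ### Coupling time and contraction of the semigroup -/

section Contraction

variable {E : Type*} [TopologicalSpace E] [PolishSpace E] [MeasurableSpace E] [BorelSpace E]
  {X : FellerProcess E} {ρ : E → E → ℝ≥0∞}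

namespace FellerProcess

/-- Right-continuity of the paths at time `0` makes the laws `δ_x S_t` determine `x` as `t → 0`. -/
lemma eq_of_forall_distr_eq {x y : E} (h : ∀ t : ℝ≥0, 0 < t → X.distr t x = X.distr t y) :
    x = y := by
  have := X.isMarkovKernel
  let u : ℕ → ℝ≥0 := fun n => 1 / ((n : ℝ≥0) + 1)
  have hu0 : ∀ n, 0 < u n := fun n => by positivity
  have hu : Tendsto u atTop (𝓝[≥] 0) :=
    tendsto_nhdsWithin_iff.2 ⟨tendsto_one_div_add_atTop_nhds_zero_nat,
      Eventually.of_forall fun n => (zero_le : 0 ≤ u n)⟩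
  have hlim : ∀ (f : E →ᵇ ℝ) (z : E),
      Tendsto (fun n => ∫ w, f w ∂(X.distr (u n) z)) atTop (𝓝 (f z)) := by
    intro f z
    have h1 : ∀ n, ∫ w, f w ∂(X.distr (u n) z) = ∫ ω, f (ω.1 (u n)) ∂(X.law z) := fun n =>
      integral_map (measurable_cadlagPath_apply _).aemeasurable
        f.continuous.measurable.aestronglyMeasurable
    have h2 : f z = ∫ _, f z ∂(X.law z) := by simp
    simp_rw [h1]
    rw [h2]
    refine tendsto_integral_of_dominated_convergence (fun _ => ‖f‖)
      (fun n => (f.continuous.measurable.comp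
        (measurable_cadlagPath_apply _)).aestronglyMeasurable)
      (integrable_const _) (fun n => ae_of_all _ fun ω => f.norm_coe_le_norm _) ?_
    filter_upwards [X.start z] with ω hω
    have h3 : Tendsto ω.1 (𝓝[≥] 0) (𝓝 (ω.1 0)) := (ω.2 0).1
    rw [hω] at h3
    exact (f.continuous.tendsto z).comp (h3.comp hu)
  have hdirac : Measure.dirac x = Measure.dirac y := by
    refine ext_of_forall_integral_eq_of_IsFiniteMeasure fun f => ?_
    rw [integral_dirac, integral_dirac]
    refine tendsto_nhds_unique (hlim f x) ?_
    simp_rw [h _ (hu0 _)]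
    exact hlim f y
  exact dirac_eq_dirac_iff.1 hdirac

/-- If the coupling time vanishes identically, then the laws of `X_t`, `t > 0`, do not depend on
the starting point: an optimal coupling of them is carried by the diagonal. -/
lemma ActsAsContraction.subsingleton_of_couplingTime_eq_zero (hX : X.ActsAsContraction ρ)
    (hlsc : LowerSemicontinuous fun z : E × E => ρ z.1 z.2) (hρ : IsMetric ρ)
    (h : ∀ x y, X.couplingTime ρ x y = 0) : Subsingleton E := by
  refine ⟨fun x y => eq_of_forall_distr_eq (X := X) fun t ht => ?_⟩
  obtain ⟨π, ⟨h1, h2⟩, hπ⟩ := exists_coupling_of_forall_lipschitz hlsc hρ (μ := X.distr t x)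
    (ν := X.distr t y) (D := 0) (by
      rintro f hf ⟨B, hB⟩ hlip
      have := hX.mul_ofReal_semigroup_sub_le hf hB (fun x y => by simpa using hlip x y) t x y
      rw [h x y] at this
      have ht0 : (t : ℝ≥0∞) ≠ 0 := by simpa using ht.ne'
      simpa [ht0, semigroup] using this)
  have h0 : ∫⁻ z, ρ z.1 z.2 ∂π = 0 := by simpa using hπ
  have hdiag : ∀ᵐ z ∂π, z.1 = z.2 := by
    filter_upwards [(lintegral_eq_zero_iff hlsc.measurable).1 h0] with z hz
    exact (hρ.eq_zero_iff _ _).1 hz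
  rw [← h1, ← h2]
  exact Measure.map_congr hdiag

/-- A linear bound on the coupling time makes the semigroup contract. -/
theorem ActsAsContraction.opLipNorm_le_of_couplingTime_le (hX : X.ActsAsContraction ρ)
    (hlsc : LowerSemicontinuous fun z : E × E => ρ z.1 z.2) (hρ : IsMetric ρ) {α : ℝ}
    (hα : 1 < α) {M : ℝ≥0} (hM : ∀ x y, X.couplingTime ρ x y ≤ M * ρ x y) {t : ℝ≥0}
    (ht : (M : ℝ) * α ≤ t) : X.opLipNorm ρ t ≤ ENNReal.ofReal (1 / α) := by
  have hα0 : 0 < α := by linarith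
  refine opLipNorm_le_of_forall_bounded (q := (1 / α).toNNReal) ?_
  rintro f hf ⟨B, hB⟩ hf1 x y
  rcases eq_or_ne t 0 with rfl | ht0
  · -- At time `0` there is no decay, but then `M = 0` and the state space is trivial.
    have hM0 : M = 0 := by
      have : (M : ℝ) ≤ 0 := by
        by_contra! h
        have := mul_pos h hα0
        simp only [NNReal.coe_zero] at ht
        linarith
      exact_mod_cast le_antisymm this M.coe_nonneg
    have := hX.subsingleton_of_couplingTime_eq_zero hlsc hρ fun x y => by
      simpa [hM0] using hM x y
    rw [Subsingleton.elim x y]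
    simp
  · have ht0' : (t : ℝ≥0∞) ≠ 0 := by simpa using ht0
    set d := ENNReal.ofReal (X.semigroup t f x - X.semigroup t f y)
    have h1 : t * d ≤ M * ρ x y :=
      (hX.mul_ofReal_semigroup_sub_le hf hB hf1 t x y).trans (hM x y)
    have h2 : (M : ℝ≥0∞) ≤ t * ((1 / α).toNNReal : ℝ≥0) := by
      rw [← ENNReal.coe_mul, ENNReal.coe_le_coe, ← NNReal.coe_le_coe, NNReal.coe_mul,
        Real.coe_toNNReal _ (by positivity), mul_one_div, le_div_iff₀ hα0]
      exact ht
    have h3 : t * d ≤ t * (((1 / α).toNNReal : ℝ≥0) * ρ x y) := by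
      rw [← mul_assoc]
      exact h1.trans (by gcongr)
    exact (ENNReal.mul_le_mul_iff_right ht0' ENNReal.coe_ne_top).1 h3

lemma ActsAsContraction.couplingDist_natCast_mul_add_le (hX : X.ActsAsContraction ρ)
    (hlsc : LowerSemicontinuous fun z : E × E => ρ z.1 z.2) (hρ : IsMetric ρ) {T q : ℝ≥0}
    (hq : 0 < q) (hT : X.opLipNorm ρ T ≤ q) (k : ℕ) (s : ℝ≥0) {x y : E} (hxy : ρ x y ≠ ∞) :
    X.couplingDist ρ (k * T + s) x y ≤ (q : ℝ≥0∞) ^ k * ρ x y := by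
  have hfin : (q : ℝ≥0∞) ^ k * ρ x y ≠ ∞ :=
    ENNReal.mul_ne_top (ENNReal.pow_ne_top ENNReal.coe_ne_top) hxy
  obtain ⟨π, hπ, hle⟩ := exists_coupling_of_forall_lipschitz hlsc hρ
    (μ := X.distr (k * T + s) x) (ν := X.distr (k * T + s) y)
    (D := ((q : ℝ≥0∞) ^ k * ρ x y).toReal) (by
      rintro f hf ⟨B, hB⟩ hlip
      have := hX.isLip_semigroup_natCast_mul_add hq hT hf hB
        (fun x y => by simpa using hlip x y) k s x y
      rw [ENNReal.coe_pow] at this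
      exact (ENNReal.ofReal_le_iff_le_toReal hfin).1 this)
  rw [ENNReal.ofReal_toReal hfin] at hle
  exact (iInf₂_le π hπ).trans hle

/-- Contraction of the semigroup at one time bounds the coupling time, as
`T ∑ₖ α⁻ᵏ = α T / (α - 1)`. -/
theorem ActsAsContraction.couplingTime_le_of_opLipNorm_le (hX : X.ActsAsContraction ρ)
    (hlsc : LowerSemicontinuous fun z : E × E => ρ z.1 z.2) (hρ : IsMetric ρ) {α : ℝ}
    (hα : 1 < α) {T : ℝ≥0} (hT0 : 0 < T) (hT : X.opLipNorm ρ T ≤ ENNReal.ofReal (1 / α))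
    (x y : E) : X.couplingTime ρ x y ≤ ENNReal.ofReal (α * T / (α - 1)) * ρ x y := by
  have hα0 : 0 < α := by linarith
  have hα1 : 0 < α - 1 := by linarith
  have hT0' : (0 : ℝ) < T := by exact_mod_cast hT0
  have hpos : 0 < α * T / (α - 1) := by positivity
  rcases eq_or_ne (ρ x y) ∞ with hxy | hxy
  · rw [hxy, ENNReal.mul_top (by simpa using hpos)]
    exact le_top
  set q : ℝ≥0 := (1 / α).toNNReal
  have hq : 0 < q := Real.toNNReal_pos.2 (by positivity)
  have hcover : Set.Ici (0 : ℝ) ⊆ ⋃ k : ℕ, Set.Ico (k * T : ℝ) ((k + 1) * T) := by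
    intro t ht
    have ht : 0 ≤ t := ht
    refine Set.mem_iUnion.2 ⟨⌊t / T⌋₊, ?_, ?_⟩
    · exact (le_div_iff₀ hT0').1 (Nat.floor_le (by positivity))
    · exact (div_lt_iff₀ hT0').1 (Nat.lt_floor_add_one _)
  have hpiece : ∀ k : ℕ, ∫⁻ t in Set.Ico (k * T : ℝ) ((k + 1) * T),
      X.couplingDist ρ t.toNNReal x y ≤ (q : ℝ≥0∞) ^ k * (ρ x y * T) := by
    intro k
    calc ∫⁻ t in Set.Ico (k * T : ℝ) ((k + 1) * T), X.couplingDist ρ t.toNNReal x y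
        ≤ ∫⁻ _ in Set.Ico (k * T : ℝ) ((k + 1) * T), (q : ℝ≥0∞) ^ k * ρ x y := by
          refine setLIntegral_mono' measurableSet_Ico fun t ht => ?_
          have hkt : (k : ℝ≥0) * T ≤ t.toNNReal := by
            rw [← NNReal.coe_le_coe, Real.coe_toNNReal _ (le_trans (by positivity) ht.1)]
            exact_mod_cast ht.1
          rw [← add_tsub_cancel_of_le hkt]
          exact hX.couplingDist_natCast_mul_add_le hlsc hρ hq hT k _ hxy
      _ = (q : ℝ≥0∞) ^ k * (ρ x y * T) := by
          rw [setLIntegral_const, Real.volume_Ico, show ((k : ℝ) + 1) * T - k * T = T by ring,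
            ENNReal.ofReal_coe_nnreal, mul_assoc]
  calc X.couplingTime ρ x y
      ≤ ∫⁻ t in ⋃ k : ℕ, Set.Ico (k * T : ℝ) ((k + 1) * T), X.couplingDist ρ t.toNNReal x y :=
        lintegral_mono_set hcover
    _ ≤ ∑' k : ℕ, ∫⁻ t in Set.Ico (k * T : ℝ) ((k + 1) * T), X.couplingDist ρ t.toNNReal x y :=
        lintegral_iUnion_le _ _
    _ ≤ ∑' k : ℕ, (q : ℝ≥0∞) ^ k * (ρ x y * T) := ENNReal.tsum_le_tsum hpiece
    _ = (1 - (q : ℝ≥0∞))⁻¹ * T * ρ x y := by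
        rw [ENNReal.tsum_mul_right, ENNReal.tsum_geometric]
        ring
    _ = ENNReal.ofReal (α * T / (α - 1)) * ρ x y := by
        have h1 : 1 - (q : ℝ≥0∞) = ENNReal.ofReal ((α - 1) / α) := by
          rw [show (α - 1) / α = 1 - 1 / α by field_simp,
            ENNReal.ofReal_sub _ (by positivity), ENNReal.ofReal_one]
          rfl
        rw [h1, ← ENNReal.ofReal_inv_of_pos (by positivity), ← ENNReal.ofReal_coe_nnreal (p := T),
          ← ENNReal.ofReal_mul (by positivity)]
        congr 2
        field_simp

end FellerProcess

end Contraction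

end CouplingTime

theorem mainTheorem5 {E : Type*} [TopologicalSpace E] [PolishSpace E] [MeasurableSpace E]
    [BorelSpace E] (X : CouplingTime.FellerProcess E) (ρ : E → E → ℝ≥0∞)
    (hlsc : LowerSemicontinuous fun z : E × E => ρ z.1 z.2)
    (hmetric : CouplingTime.IsMetric ρ)
    (hcontr : X.ActsAsContraction ρ) :
    ((∃ M : ℝ≥0, ∀ x y : E, X.couplingTime ρ x y ≤ (M : ℝ≥0∞) * ρ x y) ↔
      X.ExponentiallyContracting ρ) ∧
    ∀ α : ℝ, 1 < α →
      (∀ M : ℝ≥0, (∀ x y : E, X.couplingTime ρ x y ≤ (M : ℝ≥0∞) * ρ x y) →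
        ∀ t : ℝ≥0, (M : ℝ) * α ≤ (t : ℝ) → X.opLipNorm ρ t ≤ ENNReal.ofReal (1 / α)) ∧
      (∀ T : ℝ≥0, 0 < T → X.opLipNorm ρ T ≤ ENNReal.ofReal (1 / α) →
        ∀ x y : E,
          X.couplingTime ρ x y ≤ ENNReal.ofReal (α * (T : ℝ) / (α - 1)) * ρ x y) := by
  refine ⟨⟨fun ⟨M, hM⟩ => ?_, fun h => ?_⟩, fun α hα => ⟨fun M hM t ht => ?_, fun T hT0 hT => ?_⟩⟩
  · -- The summand `1` keeps the time positive when `M = 0`.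
    refine hcontr.exponentiallyContracting (T := M * 2 + 1) (by positivity)
      (hcontr.opLipNorm_le_of_couplingTime_le hlsc hmetric one_lt_two hM ?_)
    push_cast
    linarith
  · obtain ⟨T, hT0, hT⟩ := h.exists_opLipNorm_le
    exact ⟨(2 * (T : ℝ) / (2 - 1)).toNNReal,
      hcontr.couplingTime_le_of_opLipNorm_le hlsc hmetric one_lt_two hT0 hT⟩
  · exact hcontr.opLipNorm_le_of_couplingTime_le hlsc hmetric hα hM ht
  · exact hcontr.couplingTime_le_of_opLipNorm_le hlsc hmetric hα hT0 hT
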